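/- All graphs are finite and simple, and classes of graphs are closed under isomorphism. A class is hereditary if it is closed under induced subgraphs. A balanced separator of an $n$-vertex graph $G$ is a set $X\subseteq V(G)$ such that each component of $G-X$ has at most $2n/3$ vertices; $s(G)$ is the minimum size of a balanced separator of $G$, and for a class $\mathcal G$ let $s_{\mathcal G}(n)=\max\{s(G):G\in\mathcal G,\ |V(G)|\le n\}$. For an integer $r\ge 0$, an $r$-shallow minor of $G$ is a graph obtained from a subgraph of $G$ by contracting pairwise vertex-disjoint subgraphs, each of radius at most $r$. Let $\nabla_r(G)$ be the maximum of $|E(H)|/|V(H)|$ over the $r$-shallow minors $H$ of $G$, and let $\nabla_{\mathcal G}(r)=\sup\{\nabla_r(G):G\in\mathcal G\}\in[0,\infty]$. For $0<\varepsilon\le 1$, let $b_\varepsilon$ be the supremum of the real numbers $b$ such that every hereditary class $\mathcal G$ with $s_{\mathcal G}(n)=\Theta(n^{1-\varepsilon})$ satisfies $\nabla_{\mathcal G}(r)=\Omega(r^b)$, and let $B_\varepsilon$ be the infimum of the real numbers $B$ such that every hereditary class $\mathcal G$ with $s_{\mathcal G}(n)=\Theta(n^{1-\varepsilon})$ satisfies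 $\nabla_{\mathcal G}(r)=O(r^B)$ (supremum and infimum in $[-\infty,\infty]$). **Lemma.** For every positive even integer $d$, $$b_{1/d}\le \frac d2\le B_{1/d}.$$ Moreover, let $Q_n^d$ be the graph with vertex set $\{1,\dots,n\}^d$ in which two distinct vertices are adjacent if and only if they differ by at most $2$ in each coordinate, and let $\mathcal G_d$ be the class of all graphs isomorphic to an induced subgraph of $Q_n^d$ for some $n\in\mathbb N$. Then $\mathcal G_d$ is hereditary, $s_{\mathcal G_d}(n)=\Theta(n^{1-1/d})$, $\nabla_{\mathcal G_d}(r)=\Theta(r^{d/2})$, and for every integer $r\ge 1$ the complete bipartite graph $K_{(2r)^{d/2}/2,\,(2r)^{d/2}}$ is an $r$-shallow minor of $Q_{2r}^d$. -/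

import Mathlib

open Filter Asymptotics
open scoped ENNReal

namespace ShallowMinors

/-! Separators -/

/-- `X` is a balanced separator of the `n`-vertex graph `G`: each component of `G - X` has at most
`2n/3` vertices. -/
def IsBalancedSeparator {V : Type*} [Fintype V] (G : SimpleGraph V) (X : Finset V) : Prop :=
  ∀ C : (G.induce ((X : Set V)ᶜ)).ConnectedComponent,
    (C.supp.ncard : ℝ) ≤ 2 * (Fintype.card V : ℝ) / 3

/-- `s(G)`: the minimum size of a balanced separator of `G`. -/
noncomputable def minSeparator {V : Type*} [Fintype V] (G : SimpleGraph V) : ℕ :=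
  sInf {k | ∃ X : Finset V, IsBalancedSeparator G X ∧ X.card = k}

/-- A class of finite graphs, given by its members on the vertex sets `Fin n`
(every finite graph is isomorphic to one of these). -/
abbrev GraphClass := (n : ℕ) → Set (SimpleGraph (Fin n))

/-- The class is hereditary: closed under induced subgraphs (and under isomorphism). -/
def GraphClass.Hereditary (𝒢 : GraphClass) : Prop :=
  ∀ (m n : ℕ) (H : SimpleGraph (Fin m)) (G : SimpleGraph (Fin n)),
    G ∈ 𝒢 n → Nonempty (H ↪g G) → H ∈ 𝒢 m

/-- The set `{s(G) : G ∈ 𝒢, |V(G)| ≤ n}`. -/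
def GraphClass.separatorSizes (𝒢 : GraphClass) (n : ℕ) : Set ℕ :=
  {k | ∃ m ≤ n, ∃ G ∈ 𝒢 m, minSeparator G = k}

/-- `s_𝒢(n) = max {s(G) : G ∈ 𝒢, |V(G)| ≤ n}`. -/
noncomputable def GraphClass.separator (𝒢 : GraphClass) (n : ℕ) : ℕ :=
  sSup (𝒢.separatorSizes n)

/-- The whole vertex set is a balanced separator, so the minimum defining `s(G)` is over a
nonempty set. -/
theorem isBalancedSeparator_univ {V : Type*} [Fintype V] (G : SimpleGraph V) :
    IsBalancedSeparator G Finset.univ := by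
  intro C
  obtain ⟨⟨v, hv⟩, _⟩ := C.exists_rep
  simp at hv

theorem minSeparator_le_card {V : Type*} [Fintype V] (G : SimpleGraph V) :
    minSeparator G ≤ Fintype.card V :=
  Nat.sInf_le ⟨Finset.univ, isBalancedSeparator_univ G, Finset.card_univ⟩

/-- The maximum defining `s_𝒢(n)` is over a bounded set. -/
theorem GraphClass.separatorSizes_bddAbove (𝒢 : GraphClass) (n : ℕ) :
    BddAbove (𝒢.separatorSizes n) := by
  refine ⟨n, ?_⟩
  rintro k ⟨m, hm, G, -, rfl⟩
  exact (minSeparator_le_card G).trans (by simpa using hm)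

/-! Shallow minors and expansion -/

/-- `H` is (isomorphic to) an `r`-shallow minor of `G`: the vertex `w` of `H` arises by contracting
the subgraph `S w` of `G` (a single vertex if nothing is contracted); these subgraphs are pairwise
vertex-disjoint and have radius at most `r` (so they are nonempty and connected), and each edge of
`H` comes from an edge of `G` between the corresponding subgraphs. The other edges between them need
not be edges of `H`, since one contracts in an arbitrary subgraph of `G`. -/
def IsShallowMinor {V W : Type*} (r : ℕ) (H : SimpleGraph W) (G : SimpleGraph V) : Prop :=
  ∃ S : W → G.Subgraph,
    (∀ w, (S w).coe.radius ≤ r) ∧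
    (∀ u w, u ≠ w → Disjoint (S u).verts (S w).verts) ∧
    (∀ u w, H.Adj u w → ∃ x ∈ (S u).verts, ∃ y ∈ (S w).verts, G.Adj x y)

/-- The density `|E(H)| / |V(H)|` (zero for the graph without vertices). -/
noncomputable def density {W : Type*} [Fintype W] (H : SimpleGraph W) : ℝ≥0∞ :=
  (H.edgeSet.ncard : ℝ≥0∞) / (Fintype.card W : ℝ≥0∞)

/-- `∇_r(G)`: the maximum density of an `r`-shallow minor of `G`. -/
noncomputable def nablaGraph {V : Type*} [Fintype V] (r : ℕ) (G : SimpleGraph V) : ℝ≥0∞ :=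
  sSup {x | ∃ (m : ℕ) (H : SimpleGraph (Fin m)), IsShallowMinor r H G ∧ density H = x}

/-- `∇_𝒢(r) = sup {∇_r(G) : G ∈ 𝒢}`, possibly infinite. -/
noncomputable def GraphClass.nabla (𝒢 : GraphClass) (r : ℕ) : ℝ≥0∞ :=
  sSup {x | ∃ (n : ℕ) (G : SimpleGraph (Fin n)), G ∈ 𝒢 n ∧ nablaGraph r G = x}

/-! The exponents -/

/-- `f(r) = O(r ^ B)` as `r → ∞`, for `f` with values in `[0, ∞]`. -/
def IsBigOPow (f : ℕ → ℝ≥0∞) (B : ℝ) : Prop :=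
  ∃ C : ℝ, 0 < C ∧ ∀ᶠ r : ℕ in atTop, f r ≤ ENNReal.ofReal (C * (r : ℝ) ^ B)

/-- `f(r) = Ω(r ^ b)` as `r → ∞`, for `f` with values in `[0, ∞]`. -/
def IsBigOmegaPow (f : ℕ → ℝ≥0∞) (b : ℝ) : Prop :=
  ∃ c : ℝ, 0 < c ∧ ∀ᶠ r : ℕ in atTop, ENNReal.ofReal (c * (r : ℝ) ^ b) ≤ f r

/-- `s_𝒢(n) = Θ(n ^ (1 - ε))`. -/
def GraphClass.HasSeparatorExponent (𝒢 : GraphClass) (ε : ℝ) : Prop :=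
  (fun n : ℕ => (𝒢.separator n : ℝ)) =Θ[atTop] (fun n : ℕ => (n : ℝ) ^ (1 - ε))

/-- `b_ε`: the supremum (in `[-∞, ∞]`) of the real numbers `b` such that every hereditary class `𝒢`
with `s_𝒢(n) = Θ(n ^ (1 - ε))` satisfies `∇_𝒢(r) = Ω(r ^ b)`. -/
noncomputable def lowerExponent (ε : ℝ) : EReal :=
  sSup {x | ∃ b : ℝ, (∀ 𝒢 : GraphClass, 𝒢.Hereditary → 𝒢.HasSeparatorExponent ε →
    IsBigOmegaPow 𝒢.nabla b) ∧ (b : EReal) = x}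

/-- `B_ε`: the infimum (in `[-∞, ∞]`) of the real numbers `B` such that every hereditary class `𝒢`
with `s_𝒢(n) = Θ(n ^ (1 - ε))` satisfies `∇_𝒢(r) = O(r ^ B)`. -/
noncomputable def upperExponent (ε : ℝ) : EReal :=
  sInf {x | ∃ B : ℝ, (∀ 𝒢 : GraphClass, 𝒢.Hereditary → 𝒢.HasSeparatorExponent ε →
    IsBigOPow 𝒢.nabla B) ∧ (B : EReal) = x}

/-! Grids -/

/-- The grid `Q_n^d`: the vertices are the `d`-tuples of elements of an `n`-element interval of
integers, and two distinct vertices are adjacent if they differ by at most `2` in each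
coordinate. -/
def grid (n d : ℕ) : SimpleGraph (Fin d → Fin n) where
  Adj x y := x ≠ y ∧ ∀ i, |((x i : ℕ) : ℤ) - ((y i : ℕ) : ℤ)| ≤ 2
  symm := ⟨fun x y h => ⟨h.1.symm, fun i => by rw [abs_sub_comm]; exact h.2 i⟩⟩
  loopless := ⟨fun _ h => h.1 rfl⟩

/-- The class of all induced subgraphs of the grids `Q_n^d`, `n ∈ ℕ`, for fixed `d`. -/
def gridClass (d : ℕ) : GraphClass :=
  fun m => {H : SimpleGraph (Fin m) | ∃ n : ℕ, Nonempty (H ↪g grid n d)}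

end ShallowMinors

/-!
The upper bounds use only that a graph in the class sits injectively in `ℤ ^ d` with adjacent
vertices at most `2` apart in each coordinate (`IsLatticeEmbedding`).

Density. Put `d = 2 k`. In an `r`-shallow minor, a branch set with at most `r ^ k` vertices is
adjacent to `O(r ^ k)` others, because degrees are bounded. The neighbours of any branch set lie in a
lattice cube of side `O(r)`, which has `O(r ^ (2 k))` points, so at most `O(r ^ k)` of them have
`r ^ k` or more vertices. Every edge is counted in one of these two ways
(`ncard_edgeSet_le_of_isShallowMinor`). The bound is sharp because fibres of the two projections of
`{1, …, 2 r} ^ k × {1, …, 2 r} ^ k` cross each other; steps of length `2` leave room to make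
crossing fibres disjoint (`isShallowMinor_completeBipartiteGraph`).

Separators. For an `m`-vertex graph in the class, deleting two consecutive residue classes modulo
about `m ^ (1 / d)` in each coordinate leaves components in cubes with at most `2 m / 3` points; for
the best choice of the residues only `O(m ^ (1 - 1 / d))` vertices are deleted
(`IsLatticeEmbedding.exists_isBalancedSeparator`). Conversely, join each pair of vertices of the
grid `Q_n^d` by the path that corrects one coordinate after the other. Each vertex lies on
the lines used by at most `d n ^ (d + 1)` pairs, and a balanced separator meets the lines of at least
`n ^ (2 d) / 3` pairs, so it has at least `n ^ (d - 1) / (3 d)` vertices (`le_card_of_isBalancedSeparator`).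

The inequalities for the two exponents follow, as the class has separator exponent `1 / d` and
density of order `r ^ (d / 2)`.
-/

namespace ShallowMinors

/-! ### Graphs of small steps in the integer lattice -/

/-- `ψ` places the vertices of `G` injectively in `ℤ ^ d` so that adjacent vertices differ by at
most `2` in each coordinate. These are, up to translation, the inclusions of `G` into the grids as a
subgraph that need not be induced. -/
structure IsLatticeEmbedding {V : Type*} (G : SimpleGraph V) {d : ℕ} (ψ : V → Fin d → ℤ) :
    Prop where
  injective : Function.Injective ψ
  abs_sub_le : ∀ ⦃x y⦄, G.Adj x y → ∀ i, |ψ x i - ψ y i| ≤ 2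

theorem exists_isLatticeEmbedding {d m : ℕ} {G : SimpleGraph (Fin m)} (hG : G ∈ gridClass d m) :
    ∃ ψ : Fin m → Fin d → ℤ, IsLatticeEmbedding G ψ := by
  obtain ⟨n, ⟨f⟩⟩ := hG
  refine ⟨fun v i => ((f v i : ℕ) : ℤ), fun x y h => f.injective ?_, fun x y h => ?_⟩
  · funext i
    have := congrFun h i
    exact Fin.ext (by exact_mod_cast this)
  · exact (f.map_rel_iff.2 h).2

/-- An injectively placed set of vertices that lies in a product of `d` integer intervals with `L`
elements each has at most `L ^ d` elements. -/
theorem card_le_pow_of_mem_Ico {V : Type*} {d : ℕ} {ψ : V → Fin d → ℤ}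
    (hψ : Function.Injective ψ) (A : Finset V) (c : Fin d → ℤ) (L : ℕ)
    (hA : ∀ v ∈ A, ∀ i, ψ v i ∈ Finset.Ico (c i) (c i + L)) : A.card ≤ L ^ d := by
  classical
  calc A.card = (A.image ψ).card := (Finset.card_image_of_injective A hψ).symm
    _ ≤ (Fintype.piFinset fun i => Finset.Ico (c i) (c i + L)).card := by
        refine Finset.card_le_card fun z hz => ?_
        obtain ⟨v, hv, rfl⟩ := Finset.mem_image.1 hz
        exact Fintype.mem_piFinset.2 (hA v hv)
    _ = L ^ d := by simp

theorem card_le_pow_of_abs_sub_le {V : Type*} {d : ℕ} {ψ : V → Fin d → ℤ}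
    (hψ : Function.Injective ψ) (A : Finset V) (c : Fin d → ℤ) (R : ℕ)
    (hA : ∀ v ∈ A, ∀ i, |ψ v i - c i| ≤ R) : A.card ≤ (2 * R + 1) ^ d := by
  refine card_le_pow_of_mem_Ico hψ A (fun i => c i - R) _ fun v hv i => ?_
  have := abs_le.1 (hA v hv i)
  rw [Finset.mem_Ico]
  push_cast
  omega

/-! ### The upper bound for the density of shallow minors -/

theorem abs_sub_le_of_walk {V : Type*} {G : SimpleGraph V} {d : ℕ} {ψ : V → Fin d → ℤ}
    (h : ∀ ⦃x y⦄, G.Adj x y → ∀ i, |ψ x i - ψ y i| ≤ 2) {x y : V} (p : G.Walk x y) (i : Fin d) :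
    |ψ x i - ψ y i| ≤ 2 * p.length := by
  induction p with
  | nil => simp
  | @cons u v w huv p ih =>
    have h1 := h huv i
    rw [SimpleGraph.Walk.length_cons]
    push_cast
    rw [abs_le] at *
    constructor <;> linarith [h1.1, h1.2, ih.1, ih.2]

/-- A subgraph of radius at most `r` lies in a lattice cube of side `4 r`. -/
theorem IsLatticeEmbedding.exists_center {V : Type*} {G : SimpleGraph V} {d r : ℕ}
    {ψ : V → Fin d → ℤ} (h : IsLatticeEmbedding G ψ) (S : G.Subgraph) (hS : S.coe.radius ≤ r) :
    ∃ c ∈ S.verts, ∀ v ∈ S.verts, ∀ i, |ψ v i - ψ c i| ≤ (2 * r : ℕ) := by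
  have hne : Nonempty S.verts := by
    by_contra hemp
    rw [not_nonempty_iff] at hemp
    rw [SimpleGraph.radius_eq_top_of_isEmpty] at hS
    exact absurd hS (by simp)
  obtain ⟨c, hc⟩ := S.coe.exists_eccent_eq_radius
  refine ⟨c, c.2, fun v hv i => ?_⟩
  have hle : S.coe.edist ⟨v, hv⟩ c ≤ r := by
    rw [SimpleGraph.edist_comm]
    exact (SimpleGraph.edist_le_eccent).trans (hc.le.trans hS)
  obtain ⟨p, hp⟩ := SimpleGraph.exists_walk_of_edist_ne_top
    (ne_top_of_le_ne_top (ENat.natCast_ne_top r) hle)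
  have hlen : p.length ≤ r := by
    rw [← hp] at hle
    exact_mod_cast hle
  have := abs_sub_le_of_walk (ψ := fun x : S.verts => ψ x)
    (fun x y hxy => h.abs_sub_le (S.adj_sub hxy)) p i
  push_cast
  have : (p.length : ℤ) ≤ r := by exact_mod_cast hlen
  simp only at *
  linarith

/-- If every edge `uw` of `H` is listed in `D u` or in `D w`, and no list is longer than `K`, then
`H` has at most `K |V(H)|` edges. -/
theorem ncard_edgeSet_le_of_cover {W : Type*} [Fintype W] (H : SimpleGraph W) (D : W → Finset W)
    (K : ℕ) (hK : ∀ w, (D w).card ≤ K) (hD : ∀ u w, H.Adj u w → w ∈ D u ∨ u ∈ D w) :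
    H.edgeSet.ncard ≤ K * Fintype.card W := by
  classical
  have hsub : H.edgeSet ⊆
      ((Finset.univ.biUnion fun u => (D u).image fun w => s(u, w) : Finset (Sym2 W)) :
        Set (Sym2 W)) := by
    intro e
    induction e using Sym2.ind with
    | _ u w =>
      intro he
      rw [Finset.mem_coe, Finset.mem_biUnion]
      rcases hD u w he with h | h
      · exact ⟨u, Finset.mem_univ _, Finset.mem_image.2 ⟨w, h, rfl⟩⟩
      · exact ⟨w, Finset.mem_univ _, Finset.mem_image.2 ⟨u, h, Sym2.eq_swap⟩⟩
  calc H.edgeSet.ncard ≤ _ := Set.ncard_le_ncard hsub (Finset.finite_toSet _)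
    _ = _ := Set.ncard_coe_finset _
    _ ≤ ∑ u : W, ((D u).image fun w => s(u, w)).card := Finset.card_biUnion_le
    _ ≤ ∑ _u : W, K := Finset.sum_le_sum fun u _ => Finset.card_image_le.trans (hK u)
    _ = K * Fintype.card W := by simp [mul_comm]

/-- A vertex has at most `5 ^ d` neighbours, so a set `A` of vertices has edges to at most `5 ^ d |A|`
of the disjoint sets `T u`. -/
theorem card_le_of_forall_exists_adj {V W : Type*} [Fintype V] {G : SimpleGraph V}
    {d : ℕ} {ψ : V → Fin d → ℤ} (h : IsLatticeEmbedding G ψ) (T : W → Finset V)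
    (hdisj : ∀ u w, u ≠ w → Disjoint (T u) (T w)) (A : Finset V) (N : Finset W)
    (hN : ∀ u ∈ N, ∃ x ∈ A, ∃ y ∈ T u, G.Adj x y) : N.card ≤ A.card * 5 ^ d := by
  classical
  obtain rfl | ⟨u₀, hu₀⟩ := N.eq_empty_or_nonempty
  · simp
  have : Nonempty V := ⟨(hN u₀ hu₀).choose⟩
  choose! f hf g hg hadj using hN
  have hginj : Set.InjOn g (N : Set W) := by
    intro u hu w hw huw
    by_contra hne
    exact Finset.disjoint_left.1 (hdisj u w hne) (hg u hu) (huw ▸ hg w hw)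
  calc N.card = (N.image g).card := (Finset.card_image_of_injOn hginj).symm
    _ ≤ (A.biUnion fun x => Finset.univ.filter fun y => G.Adj x y).card := by
        refine Finset.card_le_card fun y hy => ?_
        obtain ⟨u, hu, rfl⟩ := Finset.mem_image.1 hy
        exact Finset.mem_biUnion.2 ⟨f u, hf u hu, by simpa using hadj u hu⟩
    _ ≤ A.card * 5 ^ d := by
        refine Finset.card_biUnion_le_card_mul _ _ _ fun x _ => ?_
        refine card_le_pow_of_abs_sub_le h.injective _ (ψ x) 2 fun v hv i => ?_
        rw [abs_sub_comm]
        exact_mod_cast h.abs_sub_le (Finset.mem_filter.1 hv).2 i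

/-- A volume bound: disjoint sets with at least `s` vertices each, all in one lattice cube of side
`2 R`, number at most `(2 R + 1) ^ d / s`. -/
theorem card_mul_le_of_large {V W : Type*} {d : ℕ} {ψ : V → Fin d → ℤ}
    (hψ : Function.Injective ψ) (T : W → Finset V)
    (hdisj : ∀ u w, u ≠ w → Disjoint (T u) (T w)) (N : Finset W) (s R : ℕ) (c : Fin d → ℤ)
    (hs : ∀ u ∈ N, s ≤ (T u).card) (hR : ∀ u ∈ N, ∀ v ∈ T u, ∀ i, |ψ v i - c i| ≤ R) :
    N.card * s ≤ (2 * R + 1) ^ d := by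
  classical
  calc N.card * s = ∑ _u ∈ N, s := by simp
    _ ≤ ∑ u ∈ N, (T u).card := Finset.sum_le_sum hs
    _ = (N.biUnion T).card := (Finset.card_biUnion fun u _ w _ huw => hdisj u w huw).symm
    _ ≤ _ := card_le_pow_of_abs_sub_le hψ _ c R fun v hv => by
        obtain ⟨u, hu, hv⟩ := Finset.mem_biUnion.1 hv
        exact hR u hu v hv

/-- A vertex `w` of `H` is charged its edge `wu` if the branch set of `w` has at most `r ^ k` vertices
or that of `u` has at least `r ^ k`. Every edge is charged to one of its ends, and each vertex is
charged at most `17 ^ d r ^ k` edges: by the degree bound if its branch set has at most `r ^ k`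
vertices, and by the volume bound otherwise. -/
theorem ncard_edgeSet_le_of_isShallowMinor {V W : Type*} [Fintype V] [Fintype W]
    {G : SimpleGraph V} {H : SimpleGraph W} {k r : ℕ} (hr : 1 ≤ r) {ψ : V → Fin (k + k) → ℤ}
    (h : IsLatticeEmbedding G ψ) (hH : IsShallowMinor r H G) :
    H.edgeSet.ncard ≤ 17 ^ (k + k) * r ^ k * Fintype.card W := by
  classical
  obtain ⟨S, hrad, hdisj, hadj⟩ := hH
  choose c hc hcS using fun w => h.exists_center (S w) (hrad w)
  set T : W → Finset V := fun w => (S w).verts.toFinset with hT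
  have hTdisj : ∀ u w, u ≠ w → Disjoint (T u) (T w) := fun u w huw => by
    simpa [hT] using hdisj u w huw
  set D : W → Finset W := fun w => Finset.univ.filter fun u =>
    H.Adj w u ∧ ((T w).card ≤ r ^ k ∨ r ^ k ≤ (T u).card) with hD
  refine ncard_edgeSet_le_of_cover H D _ (fun w => ?_) fun u w huw => ?_
  · by_cases hw : (T w).card ≤ r ^ k
    · calc (D w).card ≤ (T w).card * 5 ^ (k + k) := by
            refine card_le_of_forall_exists_adj h T hTdisj _ _ fun u hu => ?_
            obtain ⟨x, hx, y, hy, hxy⟩ := hadj w u (Finset.mem_filter.1 hu).2.1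
            exact ⟨x, by simpa [hT] using hx, y, by simpa [hT] using hy, hxy⟩
        _ ≤ r ^ k * 17 ^ (k + k) := Nat.mul_le_mul hw (Nat.pow_le_pow_left (by norm_num) _)
        _ = _ := mul_comm _ _
    · have hvol : (D w).card * r ^ k ≤ (2 * (8 * r) + 1) ^ (k + k) := by
        refine card_mul_le_of_large h.injective T hTdisj (D w) _ _ (ψ (c w))
          (fun u hu => ((Finset.mem_filter.1 hu).2.2).resolve_left hw) fun u hu v hv i => ?_
        obtain ⟨x, hx, y, hy, hxy⟩ := hadj w u (Finset.mem_filter.1 hu).2.1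
        -- From `v` to the centre of `u` to `y`, over to `x`, and to the centre of `w`:
        -- at most `2 r + 2 r + 2 + 2 r ≤ 8 r`.
        have h1 := abs_le.1 (hcS u v (by simpa [hT] using hv) i)
        have h2 := abs_le.1 (hcS u y hy i)
        have h3 := abs_le.1 (h.abs_sub_le hxy i)
        have h4 := abs_le.1 (hcS w x hx i)
        rw [abs_le]
        push_cast at *
        omega
      have hpos : 0 < r ^ k := Nat.pow_pos hr
      refine Nat.le_of_mul_le_mul_right (hvol.trans ?_) hpos
      calc (2 * (8 * r) + 1) ^ (k + k) ≤ (17 * r) ^ (k + k) :=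
            Nat.pow_le_pow_left (by omega) _
        _ = _ := by rw [mul_pow, pow_add r]; ring
  · rcases le_total (T u).card (r ^ k) with hu | hu
    · exact .inl (Finset.mem_filter.2 ⟨Finset.mem_univ _, huw, .inl hu⟩)
    · exact .inr (Finset.mem_filter.2 ⟨Finset.mem_univ _, huw.symm, .inr hu⟩)

theorem nabla_gridClass_le (k : ℕ) {r : ℕ} (hr : 1 ≤ r) :
    (gridClass (k + k)).nabla r ≤ ((17 ^ (k + k) * r ^ k : ℕ) : ℝ≥0∞) := by
  refine sSup_le ?_
  rintro _ ⟨n, G, hG, rfl⟩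
  refine sSup_le ?_
  rintro _ ⟨m, H, hH, rfl⟩
  obtain ⟨ψ, hψ⟩ := exists_isLatticeEmbedding hG
  refine ENNReal.div_le_of_le_mul ?_
  exact_mod_cast ncard_edgeSet_le_of_isShallowMinor hr hψ hH

/-! ### Complete bipartite shallow minors of the grid -/

/-- The position after one step of length at most `2` from `a` towards `b`. A step of length `1` is
made only if `a` and `b` are at distance `1`, so parity is kept if `a` and `b` have the same
parity. -/
def stepTowards {n : ℕ} (a b : Fin n) : Fin n :=
  if h : (a : ℕ) + 2 ≤ b then ⟨a + 2, by omega⟩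
  else if (b : ℕ) + 2 ≤ a then ⟨a - 2, by omega⟩ else b

theorem coe_stepTowards {n : ℕ} (a b : Fin n) : (stepTowards a b : ℕ) =
    if (a : ℕ) + 2 ≤ b then (a : ℕ) + 2 else if (b : ℕ) + 2 ≤ a then (a : ℕ) - 2 else b := by
  unfold stepTowards
  split_ifs <;> rfl

theorem stepTowards_self {n : ℕ} (a : Fin n) : stepTowards a a = a := by
  simp [stepTowards]

theorem edist_induce_le {n d : ℕ} {s : Set (Fin d → Fin n)}
    (hs : ∀ u ∈ s, ∀ v ∈ s, (fun i => stepTowards (u i) (v i)) ∈ s) (r : ℕ) :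
    ∀ u v : ((⊤ : (grid n d).Subgraph).induce s).verts,
      (∀ i, |((u.1 i : ℕ) : ℤ) - ((v.1 i : ℕ) : ℤ)| ≤ (2 * r : ℕ)) →
        ((⊤ : (grid n d).Subgraph).induce s).coe.edist u v ≤ r := by
  induction r with
  | zero =>
    intro u v h
    have : u = v := by
      refine Subtype.ext (funext fun i => Fin.ext ?_)
      have := abs_le.1 (h i)
      omega
    simp [this]
  | succ r ih =>
    intro u v h
    let w : ((⊤ : (grid n d).Subgraph).induce s).verts :=
      ⟨fun i => stepTowards (u.1 i) (v.1 i), hs u.1 u.2 v.1 v.2⟩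
    have hw : ∀ i, ((w.1 i : Fin n) : ℕ) = if (u.1 i : ℕ) + 2 ≤ v.1 i then (u.1 i : ℕ) + 2
        else if (v.1 i : ℕ) + 2 ≤ u.1 i then (u.1 i : ℕ) - 2 else v.1 i :=
      fun i => coe_stepTowards _ _
    have huw : ((⊤ : (grid n d).Subgraph).induce s).coe.edist u w ≤ 1 := by
      rw [SimpleGraph.edist_le_one_iff_adj_or_eq]
      by_cases heq : u = w
      · exact .inr heq
      · refine .inl ⟨u.2, w.2, fun h => heq (Subtype.ext h), fun i => ?_⟩
        have := hw i
        rw [abs_le]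
        split_ifs at this <;> omega
    have hwv : ((⊤ : (grid n d).Subgraph).induce s).coe.edist w v ≤ r := by
      refine ih w v fun i => ?_
      have := hw i
      have h' := abs_le.1 (h i)
      rw [abs_le]
      push_cast at *
      split_ifs at this <;> omega
    calc _ ≤ _ := SimpleGraph.edist_triangle (v := w)
      _ ≤ 1 + (r : ℕ∞) := add_le_add huw hwv
      _ = ((r + 1 : ℕ) : ℕ∞) := by push_cast; exact add_comm _ _

theorem radius_induce_le {r d : ℕ} {s : Set (Fin d → Fin (2 * r))} (hne : s.Nonempty)
    (hs : ∀ u ∈ s, ∀ v ∈ s, (fun i => stepTowards (u i) (v i)) ∈ s) :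
    ((⊤ : (grid (2 * r) d).Subgraph).induce s).coe.radius ≤ r := by
  obtain ⟨u, hu⟩ := hne
  refine (SimpleGraph.radius_le_eccent (u := ⟨u, hu⟩)).trans ?_
  rw [SimpleGraph.eccent_le_iff]
  refine fun v => edist_induce_le hs r _ _ fun i => ?_
  have h1 := (u i).2
  have h2 := (v.1 i).2
  rw [abs_le]
  push_cast
  constructor <;> omega

/-- Split the coordinates into two blocks of length `k`. The branch sets are the fibres over the
points of the first block with even leading coordinate, and the fibres over the points of the second
block without the points that have an even leading coordinate. Steps of length `2` keep them
connected, and two fibres of different kind come within distance `1`. -/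
theorem isShallowMinor_completeBipartiteGraph (k r : ℕ) (hk : 0 < k) :
    IsShallowMinor r
      (completeBipartiteGraph (Fin ((2 * r) ^ k / 2)) (Fin ((2 * r) ^ k)))
      (grid (2 * r) (k + k)) := by
  let o : Fin k := ⟨0, hk⟩
  -- In base `2 r`, the even numbers below `(2 r) ^ k` are those with even last digit.
  let a : Fin ((2 * r) ^ k / 2) → Fin k → Fin (2 * r) := fun j =>
    finFunctionFinEquiv.symm ⟨2 * j, by have := j.2; omega⟩
  let b : Fin ((2 * r) ^ k) → Fin k → Fin (2 * r) := fun l => finFunctionFinEquiv.symm l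
  have ha : ∀ j, ((a j o : Fin (2 * r)) : ℕ) % 2 = 0 := fun j => by
    simp [a, o, finFunctionFinEquiv, Nat.mod_mod_of_dvd]
  have ha_inj : Function.Injective a := fun j j' h => by
    have := congrArg Fin.val (finFunctionFinEquiv.symm.injective h)
    exact Fin.ext (by simpa using this)
  have hb_inj : Function.Injective b := finFunctionFinEquiv.symm.injective
  let A : Fin ((2 * r) ^ k / 2) → Set (Fin (k + k) → Fin (2 * r)) := fun j =>
    {z | ∀ i, z (Fin.castAdd k i) = a j i}
  let B : Fin ((2 * r) ^ k) → Set (Fin (k + k) → Fin (2 * r)) := fun l =>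
    {z | (∀ i, z (Fin.natAdd k i) = b l i) ∧ (z (Fin.castAdd k o) : ℕ) % 2 = 1}
  -- The first block of `a j`, moved to the odd neighbour of its leading coordinate.
  let a' : Fin ((2 * r) ^ k / 2) → Fin k → Fin (2 * r) := fun j =>
    Function.update (a j) o ⟨a j o + 1, by have := ha j; have := (a j o).2; omega⟩
  have hA : ∀ j x, Fin.append (a j) x ∈ A j := fun j x i => by simp
  have hB : ∀ j l, Fin.append (a' j) (b l) ∈ B l := fun j l => by
    refine ⟨fun i => Fin.append_right _ _ i, ?_⟩
    have := ha j
    simp [a']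
    omega
  have hAB : ∀ j l, (grid (2 * r) (k + k)).Adj (Fin.append (a j) (b l))
      (Fin.append (a' j) (b l)) := fun j l => by
    refine ⟨fun h => ?_, fun i => ?_⟩
    · have := congrArg Fin.val (congrFun h (Fin.castAdd k o))
      simp [a'] at this
    · refine Fin.addCases (fun i => ?_) (fun i => ?_) i
      · by_cases hi : i = o
        · subst hi
          simp [a']
        · simp [a', hi]
      · rw [Fin.append_right, Fin.append_right]
        simp
  have hAd : ∀ j l, Disjoint (A j) (B l) := fun j l => by
    refine Set.disjoint_left.2 fun z hz hz' => ?_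
    have h1 := ha j
    have h2 := hz'.2
    rw [hz o] at h2
    omega
  refine ⟨fun w => (⊤ : (grid (2 * r) (k + k)).Subgraph).induce (Sum.elim A B w), ?_, ?_, ?_⟩
  · rintro (j | l)
    · refine radius_induce_le ⟨_, hA j (a j)⟩ fun u hu v hv i => ?_
      simp only
      rw [hu i, hv i, stepTowards_self]
    · have hpos : 0 < (2 * r) ^ k / 2 := by
        have h1 := l.2
        have h2 : 2 ∣ (2 * r) ^ k := dvd_pow (dvd_mul_right 2 r) hk.ne'
        omega
      refine radius_induce_le ⟨_, hB ⟨0, hpos⟩ l⟩ fun u hu v hv => ⟨fun i => ?_, ?_⟩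
      · simp only
        rw [hu.1 i, hv.1 i, stepTowards_self]
      · have h1 := hu.2
        have h2 := hv.2
        simp only [coe_stepTowards]
        split_ifs <;> omega
  · rintro (j | l) (j' | l') hne
    · refine Set.disjoint_left.2 fun z hz hz' => hne ?_
      exact congrArg _ (ha_inj (funext fun i => (hz i).symm.trans (hz' i)))
    · exact hAd j l'
    · exact (hAd j' l).symm
    · refine Set.disjoint_left.2 fun z hz hz' => hne ?_
      exact congrArg _ (hb_inj (funext fun i => (hz.1 i).symm.trans (hz'.1 i)))
  · rintro (j | l) (j' | l') hadj
    · simp at hadj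
    · exact ⟨_, hA j _, _, hB j l', hAB j l'⟩
    · exact ⟨_, hB j' l, _, hA j' _, (hAB j' l).symm⟩
    · simp at hadj

theorem IsShallowMinor.congr {V V' W W' : Type*} {r : ℕ} {G : SimpleGraph V} {G' : SimpleGraph V'}
    {H : SimpleGraph W} {H' : SimpleGraph W'} (h : IsShallowMinor r H G) (e : H' ≃g H)
    (f : G ≃g G') : IsShallowMinor r H' G' := by
  obtain ⟨S, hrad, hdisj, hadj⟩ := h
  refine ⟨fun w => (S (e w)).map f.toHom, fun w => ?_, fun u w huw => ?_, fun u w huw => ?_⟩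
  · have hne : Nonempty (S (e w)).verts := by
      by_contra hemp
      rw [not_nonempty_iff] at hemp
      have := hrad (e w)
      rw [SimpleGraph.radius_eq_top_of_isEmpty] at this
      exact absurd this (by simp)
    obtain ⟨c, hc⟩ := (S (e w)).coe.exists_eccent_eq_radius
    let g : (S (e w)).coe →g ((S (e w)).map f.toHom).coe :=
      { toFun := fun x => ⟨f x, x, x.2, rfl⟩
        map_rel' := fun {x y} hxy => ⟨x, y, hxy, rfl, rfl⟩ }
    refine (SimpleGraph.radius_le_eccent (u := g c)).trans ?_
    rw [SimpleGraph.eccent_le_iff]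
    rintro ⟨_, v, hv, rfl⟩
    have hle : (S (e w)).coe.edist c ⟨v, hv⟩ ≤ r :=
      SimpleGraph.edist_le_eccent.trans (hc.le.trans (hrad _))
    obtain ⟨p, hp⟩ := SimpleGraph.exists_walk_of_edist_ne_top
      (ne_top_of_le_ne_top (ENat.natCast_ne_top r) hle)
    refine (SimpleGraph.edist_le (p.map g)).trans ?_
    rw [SimpleGraph.Walk.length_map, hp]
    exact hle
  · exact (Set.disjoint_image_iff f.injective).2 (hdisj _ _ (e.injective.ne huw))
  · obtain ⟨x, hx, y, hy, hxy⟩ := hadj _ _ (e.map_rel_iff.2 huw)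
    exact ⟨f x, ⟨x, hx, rfl⟩, f y, ⟨y, hy, rfl⟩, f.map_rel_iff.2 hxy⟩

theorem density_le_nabla {𝒢 : GraphClass} {V W : Type*} [Fintype W] {r n : ℕ}
    {G : SimpleGraph V} {G' : SimpleGraph (Fin n)} {H : SimpleGraph W} (hG : G' ∈ 𝒢 n)
    (f : G ≃g G') (h : IsShallowMinor r H G) : density H ≤ 𝒢.nabla r := by
  classical
  refine le_trans ?_ (le_sSup ⟨n, G', hG, rfl⟩)
  let e : H.overFin rfl ≃g H := (H.overFinIso rfl).symm
  refine le_sSup ⟨_, H.overFin rfl, h.congr e f, ?_⟩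
  have : (H.overFin rfl).edgeSet.ncard = H.edgeSet.ncard :=
    Nat.card_congr e.mapEdgeSet
  simp [density, this]

/-- A copy of the grid `Q_n^d` in the class. -/
theorem exists_mem_gridClass (n d : ℕ) :
    ∃ G ∈ gridClass d (n ^ d), Nonempty (grid n d ≃g G) := by
  classical
  have hcard : Fintype.card (Fin d → Fin n) = n ^ d := by simp
  exact ⟨(grid n d).overFin hcard, ⟨n, ⟨((grid n d).overFinIso hcard).symm.toEmbedding⟩⟩,
    ⟨(grid n d).overFinIso hcard⟩⟩

theorem le_nabla_gridClass {k r : ℕ} (hk : 0 < k) (hr : 1 ≤ r) :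
    ((r ^ k : ℕ) : ℝ≥0∞) / 3 ≤ (gridClass (k + k)).nabla r := by
  obtain ⟨G, hG, ⟨f⟩⟩ := exists_mem_gridClass (2 * r) (k + k)
  refine le_trans ?_ (density_le_nabla hG f (isShallowMinor_completeBipartiteGraph k r hk))
  have hedge := SimpleGraph.encard_edgeSet_completeBipartiteGraph
    (W₁ := Fin ((2 * r) ^ k / 2)) (W₂ := Fin ((2 * r) ^ k))
  have hedge' : (completeBipartiteGraph (Fin ((2 * r) ^ k / 2)) (Fin ((2 * r) ^ k))).edgeSet.ncard
      = (2 * r) ^ k / 2 * (2 * r) ^ k := by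
    rw [Set.ncard, hedge, ENat.card_eq_coe_fintype_card, ENat.card_eq_coe_fintype_card,
      Fintype.card_fin, Fintype.card_fin, ← Nat.cast_mul, ENat.toNat_natCast]
  obtain ⟨h, hh⟩ : 2 ∣ (2 * r) ^ k := dvd_pow (dvd_mul_right 2 r) hk.ne'
  have hle : r ^ k ≤ 2 * h := hh ▸ Nat.pow_le_pow_left (by omega) k
  have hpos : 0 < (2 * r) ^ k := Nat.pow_pos (by omega)
  have hhalf : 2 * h / 2 = h := by omega
  rw [density, hedge', Fintype.card_sum, Fintype.card_fin, Fintype.card_fin, hh, hhalf,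
    ENNReal.le_div_iff_mul_le (.inl (by rw [Nat.cast_ne_zero]; omega))
      (.inl (ENNReal.natCast_ne_top _)),
    ENNReal.div_eq_inv_mul, mul_assoc]
  refine (ENNReal.inv_mul_le_iff (by norm_num) (by norm_num)).2 ?_
  have : r ^ k * (h + 2 * h) ≤ 3 * (h * (2 * h)) := by nlinarith
  exact_mod_cast this

/-! ### Balanced separators: the upper bound -/

/-- Some residue class `a` modulo `P` is such that `f v ≡ a` or `f v ≡ a + 1` for at most a fraction
`2 / P` of the vertices: this holds on average over `a`. -/
theorem exists_sparse_residue {V : Type*} [Fintype V] (f : V → ℤ) {P : ℕ} (hP : 0 < P) :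
    ∃ a : ℤ, P * (Finset.univ.filter fun v => (f v - a) % P < 2).card ≤ 2 * Fintype.card V := by
  classical
  have hPz : (0 : ℤ) < P := by exact_mod_cast hP
  have hv : ∀ v, ((Finset.range P).filter fun a : ℕ => (f v - a) % P < 2).card ≤ 2 := by
    intro v
    calc _ ≤ ({(f v % P).toNat, ((f v - 1) % P).toNat} : Finset ℕ).card := by
          refine Finset.card_le_card fun a ha => ?_
          obtain ⟨haP, ha⟩ := Finset.mem_filter.1 ha
          have haP' : (a : ℤ) < P := by exact_mod_cast Finset.mem_range.1 haP
          have h0 := Int.emod_nonneg (f v - a) hPz.ne'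
          have key : ∀ t : ℤ, (f v - a) % P = t → a = ((f v - t) % P).toNat := by
            intro t ht
            have h1 : (f v - t) % P = (a : ℤ) % P := by
              rw [← ht, Int.sub_emod_emod, sub_sub_cancel]
            rw [h1, Int.emod_eq_of_lt (by omega) haP']
            simp
          rw [Finset.mem_insert, Finset.mem_singleton]
          rcases (by omega : (f v - a) % P = 0 ∨ (f v - a) % P = 1) with h | h
          · exact .inl (by simpa using key 0 h)
          · exact .inr (key 1 h)
      _ ≤ 2 := Finset.card_le_two
  have hsum : ∑ a ∈ Finset.range P, (Finset.univ.filter fun v => (f v - (a : ℤ)) % P < 2).card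
      ≤ ∑ _v : V, 2 := by
    have := Finset.sum_card_bipartiteAbove_eq_sum_card_bipartiteBelow
      (s := Finset.range P) (t := (Finset.univ : Finset V))
      (fun (a : ℕ) v => (f v - (a : ℤ)) % P < 2)
    simp only [Finset.bipartiteAbove, Finset.bipartiteBelow] at this
    rw [this]
    exact Finset.sum_le_sum fun v _ => hv v
  have hle : ∑ a ∈ Finset.range P, P * (Finset.univ.filter fun v => (f v - (a : ℤ)) % P < 2).card
      ≤ ∑ _a ∈ Finset.range P, 2 * Fintype.card V := by
    rw [← Finset.mul_sum, Finset.sum_const, Finset.card_range, smul_eq_mul]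
    refine Nat.mul_le_mul_left P (hsum.trans ?_)
    simp [mul_comm]
  obtain ⟨a, -, ha⟩ := Finset.exists_le_of_sum_le (Finset.nonempty_range_iff.2 hP.ne') hle
  exact ⟨a, ha⟩

theorem ediv_eq_of_abs_sub_le {x y P : ℤ} (hP : 0 < P) (hx : 2 ≤ x % P) (hy : 2 ≤ y % P)
    (h : |x - y| ≤ 2) : x / P = y / P := by
  have h1 := Int.emod_lt_of_pos x hP
  have h2 := Int.emod_lt_of_pos y hP
  have h3 := Int.mul_ediv_add_emod x P
  have h4 := Int.mul_ediv_add_emod y P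
  have h5 := abs_le.1 h
  refine le_antisymm ?_ ?_ <;> by_contra! hlt
  · have : P * (y / P + 1) ≤ P * (x / P) := mul_le_mul_of_nonneg_left hlt hP.le
    linarith
  · have : P * (x / P + 1) ≤ P * (y / P) := mul_le_mul_of_nonneg_left hlt hP.le
    linarith

/-- Deleting two consecutive residue classes modulo `L + 2` in each coordinate leaves components
that lie in cubes with `L ^ d` lattice points. By `exists_sparse_residue` the deleted set can be
taken small. -/
theorem IsLatticeEmbedding.exists_isBalancedSeparator {V : Type*} [Fintype V] {G : SimpleGraph V}
    {d : ℕ} {ψ : V → Fin d → ℤ} (h : IsLatticeEmbedding G ψ) (L : ℕ)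
    (hL : 3 * L ^ d ≤ 2 * Fintype.card V) :
    ∃ X : Finset V, IsBalancedSeparator G X ∧ (L + 2) * X.card ≤ 2 * d * Fintype.card V := by
  classical
  choose a ha using fun i => exists_sparse_residue (fun v => ψ v i) (Nat.succ_pos (L + 1))
  set P : ℕ := L + 2 with hP
  have hPz : (0 : ℤ) < P := by rw [hP]; positivity
  set X : Finset V := Finset.univ.biUnion fun i : Fin d =>
    Finset.univ.filter fun v => (ψ v i - a i) % P < 2 with hX
  refine ⟨X, fun C => ?_, ?_⟩
  · have hres : ∀ v : ((X : Set V)ᶜ : Set V), ∀ i, 2 ≤ (ψ v i - a i) % P := by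
      intro v i
      by_contra! hlt
      exact v.2 (Finset.mem_coe.2 (Finset.mem_biUnion.2
        ⟨i, Finset.mem_univ _, Finset.mem_filter.2 ⟨Finset.mem_univ _, hlt⟩⟩))
    have hquot : ∀ u v : ((X : Set V)ᶜ : Set V), (G.induce ((X : Set V)ᶜ)).Reachable u v →
        ∀ i, (ψ u i - a i) / P = (ψ v i - a i) / P := by
      rintro u v ⟨p⟩ i
      induction p with
      | nil => rfl
      | @cons u v w huv p ih =>
        refine (ediv_eq_of_abs_sub_le hPz (hres u i) (hres v i) ?_).trans ih
        rw [sub_sub_sub_cancel_right]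
        exact h.abs_sub_le huv i
    obtain ⟨v₀, rfl⟩ := C.exists_rep
    have hcard : ((G.induce ((X : Set V)ᶜ)).connectedComponentMk v₀).supp.ncard ≤ L ^ d := by
      rw [← Set.ncard_image_of_injective _ Subtype.val_injective,
        Set.ncard_eq_toFinset_card']
      refine card_le_pow_of_mem_Ico h.injective _
        (fun i => a i + P * ((ψ v₀ i - a i) / P) + 2) L fun v hv i => ?_
      obtain ⟨w, hw, rfl⟩ := Set.mem_toFinset.1 hv
      have hq := hquot w v₀ (SimpleGraph.ConnectedComponent.exact hw) i
      have h1 := Int.mul_ediv_add_emod (ψ w i - a i) P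
      have h2 := hres w i
      have h3 := Int.emod_lt_of_pos (ψ w i - a i) hPz
      rw [hq] at h1
      rw [Finset.mem_Ico]
      have h4 : (P : ℤ) = L + 2 := by rw [hP]; push_cast; ring
      constructor
      · linarith
      · linarith
    have h1 : (3 * L ^ d : ℝ) ≤ 2 * Fintype.card V := by exact_mod_cast hL
    have h2 : ((((G.induce ((X : Set V)ᶜ)).connectedComponentMk v₀).supp.ncard : ℕ) : ℝ)
        ≤ (L : ℝ) ^ d := by exact_mod_cast hcard
    refine h2.trans ?_
    linarith
  · calc P * X.card
        ≤ P * ∑ i : Fin d, (Finset.univ.filter fun v => (ψ v i - a i) % P < 2).card :=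
          Nat.mul_le_mul_left _ Finset.card_biUnion_le
      _ = ∑ i : Fin d, P * (Finset.univ.filter fun v => (ψ v i - a i) % P < 2).card :=
          Finset.mul_sum _ _ _
      _ ≤ ∑ _i : Fin d, 2 * Fintype.card V := Finset.sum_le_sum fun i _ => ha i
      _ = 2 * d * Fintype.card V := by simp; ring

theorem minSeparator_le {d m : ℕ} (hd : 0 < d) {G : SimpleGraph (Fin m)}
    (hG : G ∈ gridClass d m) :
    (minSeparator G : ℝ) ≤ 4 * d * (m : ℝ) ^ (1 - 1 / (d : ℝ)) := by
  obtain ⟨ψ, hψ⟩ := exists_isLatticeEmbedding hG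
  rcases Nat.eq_zero_or_pos m with rfl | hm
  · have := minSeparator_le_card G
    simp only [Fintype.card_fin, Nat.le_zero] at this
    rw [this]
    simp only [Nat.cast_zero]
    positivity
  have hm' : (0 : ℝ) < m := by exact_mod_cast hm
  set t : ℝ := (m : ℝ) ^ (1 / (d : ℝ)) with ht
  have htpos : 0 < t := Real.rpow_pos_of_pos hm' _
  have htd : t ^ d = m := by
    rw [ht, ← Real.rpow_natCast, ← Real.rpow_mul hm'.le, one_div_mul_cancel (by positivity),
      Real.rpow_one]
  -- `L ^ d ≤ m / 2 ^ d ≤ 2 m / 3`, while `L + 2 ≥ m ^ (1 / d) / 2`.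
  set L : ℕ := ⌊t / 2⌋₊ with hL
  have hL1 : (L : ℝ) ≤ t / 2 := Nat.floor_le (by positivity)
  have hL2 : t / 2 < L + 1 := Nat.lt_floor_add_one _
  have hLd : 3 * L ^ d ≤ 2 * Fintype.card (Fin m) := by
    rw [Fintype.card_fin]
    have h1 : (L : ℝ) ^ d ≤ m / 2 ^ d := by
      rw [← htd, ← div_pow]
      exact pow_le_pow_left₀ (by positivity) hL1 d
    have h2 : (m : ℝ) / 2 ^ d ≤ m / 2 := by
      refine div_le_div_of_nonneg_left hm'.le (by norm_num) ?_
      exact le_self_pow₀ (by norm_num) hd.ne'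
    have h3 : (3 * L ^ d : ℝ) ≤ 2 * m := by linarith
    exact_mod_cast h3
  obtain ⟨X, hX, hcard⟩ := hψ.exists_isBalancedSeparator L hLd
  have h1 : (minSeparator G : ℝ) ≤ X.card :=
    Nat.cast_le.2 (Nat.sInf_le (m := X.card) ⟨X, hX, rfl⟩)
  have h2 : ((L : ℝ) + 2) * X.card ≤ 2 * d * m := by
    rw [Fintype.card_fin] at hcard
    exact_mod_cast hcard
  have h3 : t / 2 * X.card ≤ 2 * d * m :=
    le_trans (mul_le_mul_of_nonneg_right (by linarith) (by positivity)) h2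
  refine h1.trans ?_
  rw [Real.rpow_sub hm', Real.rpow_one, ← ht, mul_div_assoc', le_div_iff₀ htpos]
  linarith

theorem separator_gridClass_le {d : ℕ} (hd : 0 < d) (n : ℕ) :
    ((gridClass d).separator n : ℝ) ≤ 4 * d * (n : ℝ) ^ (1 - 1 / (d : ℝ)) := by
  rcases (Set.eq_empty_or_nonempty ((gridClass d).separatorSizes n)) with h | h
  · rw [GraphClass.separator, h, csSup_empty, bot_eq_zero, Nat.cast_zero]
    positivity
  obtain ⟨m, hm, G, hG, hGs⟩ := Nat.sSup_mem h ((gridClass d).separatorSizes_bddAbove n)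
  rw [GraphClass.separator, ← hGs]
  refine (minSeparator_le hd hG).trans ?_
  have hd1 : 1 / (d : ℝ) ≤ 1 := by
    rw [div_le_one (by positivity)]
    exact_mod_cast hd
  gcongr

/-! ### Balanced separators: the lower bound -/

/-- In the graph `G - X`, the vertices `x` and `y` lie in a common component. -/
def Linked {V : Type*} (G : SimpleGraph V) (X : Finset V) (x y : V) : Prop :=
  ∃ (hx : x ∈ ((X : Set V)ᶜ : Set V)) (hy : y ∈ ((X : Set V)ᶜ : Set V)),
    (G.induce ((X : Set V)ᶜ)).Reachable ⟨x, hx⟩ ⟨y, hy⟩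

theorem Linked.trans {V : Type*} {G : SimpleGraph V} {X : Finset V} {x y z : V}
    (h : Linked G X x y) (h' : Linked G X y z) : Linked G X x z := by
  obtain ⟨hx, _, h1⟩ := h
  obtain ⟨_, hz, h2⟩ := h'
  exact ⟨hx, hz, h1.trans h2⟩

theorem Linked.symm {V : Type*} {G : SimpleGraph V} {X : Finset V} {x y : V}
    (h : Linked G X x y) : Linked G X y x := by
  obtain ⟨hx, hy, h1⟩ := h
  exact ⟨hy, hx, h1.symm⟩

/-- If an axis-parallel line of the grid avoids `X`, any two of its points are linked. -/
theorem linked_update {n d : ℕ} {X : Finset (Fin d → Fin n)} {z : Fin d → Fin n} {i : Fin d}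
    (hz : ∀ t, Function.update z i t ∉ X) (s t : Fin n) :
    Linked (grid n d) X (Function.update z i s) (Function.update z i t) := by
  have key : ∀ (k : ℕ) (s t : Fin n), (t : ℕ) = s + k →
      Linked (grid n d) X (Function.update z i s) (Function.update z i t) := by
    intro k
    induction k with
    | zero =>
      intro s t hst
      obtain rfl : t = s := Fin.ext hst
      exact ⟨hz t, hz t, .rfl⟩
    | succ k ih =>
      intro s t hst
      let u : Fin n := ⟨s + k, by omega⟩
      refine (ih s u rfl).trans ⟨hz u, hz t, SimpleGraph.Adj.reachable ⟨fun h => ?_, fun j => ?_⟩⟩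
      · have := congrArg Fin.val (congrFun h i)
        simp [u] at this
        omega
      · by_cases hj : j = i
        · subst hj
          simp [u, hst, ← sub_sub]
        · simp [hj]
  rcases le_total s t with h | h
  · exact key (t - s) s t (by have : (s : ℕ) ≤ t := h; omega)
  · exact (key (s - t) t s (by have : (t : ℕ) ≤ s := h; omega)).symm

/-- The point that agrees with `y` in the coordinates below `m` and with `x` in the others. -/
def hybrid {n d : ℕ} (x y : Fin d → Fin n) (m : ℕ) : Fin d → Fin n :=
  fun j => if (j : ℕ) < m then y j else x j

theorem hybrid_succ {n d : ℕ} (x y : Fin d → Fin n) (i : Fin d) :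
    hybrid x y (i + 1) = Function.update (hybrid x y i) i (y i) := by
  funext j
  by_cases hj : j = i
  · subst hj
    simp [hybrid]
  · have hj' : (j : ℕ) ≠ i := fun h => hj (Fin.ext h)
    rw [Function.update_of_ne hj]
    simp only [hybrid]
    split_ifs <;> first | rfl | omega

/-- The canonical path from `x` to `y` corrects the coordinates one at a time, from the first to the
last. If `x` and `y` are not linked, one of the lines along which it runs meets `X`. -/
theorem exists_line_of_not_linked {n d : ℕ} {X : Finset (Fin d → Fin n)} (hd : 0 < d)
    {x y : Fin d → Fin n} (h : ¬ Linked (grid n d) X x y) :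
    ∃ (i : Fin d) (t : Fin n), Function.update (hybrid x y i) i t ∈ X := by
  by_contra! hX
  refine h ?_
  have key : ∀ m, m ≤ d → Linked (grid n d) X (hybrid x y 0) (hybrid x y m) := by
    intro m
    induction m with
    | zero =>
      intro _
      have : hybrid x y 0 ∉ X := by
        simpa using hX ⟨0, hd⟩ (hybrid x y 0 ⟨0, hd⟩)
      exact ⟨this, this, .rfl⟩
    | succ m ih =>
      intro hm
      refine (ih (by omega)).trans ?_
      have := linked_update (hX ⟨m, hm⟩) (hybrid x y m ⟨m, hm⟩) (y ⟨m, hm⟩)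
      rw [Function.update_eq_self, ← hybrid_succ] at this
      exact this
  have h0 : hybrid x y 0 = x := by funext j; simp [hybrid]
  have hd' : hybrid x y d = y := by funext j; simp [hybrid]
  have := key d le_rfl
  rwa [h0, hd'] at this

/-- If the line in direction `i` on the canonical path from `x` to `y` runs through a point `p`, then
`p` gives the entries of `y` before `i` and those of `x` after `i`. The pair is determined by `p`,
`i`, the entry `x i` and the remaining `d` entries, which form the point `hybrid y x i`. So each `p`
and `i` account for at most `n ^ (d + 1)` pairs. -/
theorem card_not_linked_le {n d : ℕ} (hd : 0 < d) (X : Finset (Fin d → Fin n))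
    (B : Finset ((Fin d → Fin n) × (Fin d → Fin n)))
    (hB : ∀ q ∈ B, ¬ Linked (grid n d) X q.1 q.2) :
    B.card ≤ d * X.card * n ^ (d + 1) := by
  classical
  have hex : ∀ q : B, ∃ c : Fin d × Fin n,
      Function.update (hybrid q.1.1 q.1.2 c.1) c.1 c.2 ∈ X := fun q => by
    obtain ⟨i, t, h⟩ := exists_line_of_not_linked hd (hB q.1 q.2)
    exact ⟨(i, t), h⟩
  choose c hc using hex
  let F : B → (Fin d × X) × (Fin n × (Fin d → Fin n)) := fun q =>
    (((c q).1, ⟨_, hc q⟩), (q.1.1 (c q).1, hybrid q.1.2 q.1.1 (c q).1))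
  have hF : Function.Injective F := by
    intro q q' h
    simp only [F, Prod.mk.injEq, Subtype.mk.injEq] at h
    obtain ⟨⟨hi, hp⟩, hxi, hw⟩ := h
    rw [← hi] at hp hxi hw
    have hxy : ∀ j, q.1.1 j = q'.1.1 j ∧ q.1.2 j = q'.1.2 j := by
      intro j
      have hpj := congrFun hp j
      have hwj := congrFun hw j
      by_cases hj : j = (c q).1
      · subst hj
        exact ⟨hxi, by simpa [hybrid] using hwj⟩
      · rw [Function.update_of_ne hj, Function.update_of_ne hj] at hpj
        simp only [hybrid] at hpj hwj
        split_ifs at hpj hwj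
        · exact ⟨hwj, hpj⟩
        · exact ⟨hpj, hwj⟩
    exact Subtype.ext (Prod.ext (funext fun j => (hxy j).1) (funext fun j => (hxy j).2))
  have := Fintype.card_le_of_injective F hF
  simp only [Fintype.card_prod, Fintype.card_fin, Fintype.card_coe, Fintype.card_fun] at this
  rw [pow_succ']
  exact this

/-- Each vertex is linked to at most `2 n ^ d / 3` vertices when `X` is a balanced separator, so at
least a third of all pairs are not linked. -/
theorem le_card_of_isBalancedSeparator {n d : ℕ} (hn : 0 < n) (hd : 0 < d)
    (X : Finset (Fin d → Fin n)) (hX : IsBalancedSeparator (grid n d) X) :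
    n ^ (d - 1) ≤ 3 * d * X.card := by
  classical
  set M : Finset ((Fin d → Fin n) × (Fin d → Fin n)) :=
    Finset.univ.filter fun q => Linked (grid n d) X q.1 q.2 with hM
  set B : Finset ((Fin d → Fin n) × (Fin d → Fin n)) :=
    Finset.univ.filter fun q => ¬ Linked (grid n d) X q.1 q.2 with hBdef
  have hsum : M.card + B.card = n ^ d * n ^ d := by
    rw [hM, hBdef, Finset.card_filter_add_card_filter_not]
    simp
  have hB : B.card ≤ d * X.card * n ^ (d + 1) :=
    card_not_linked_le hd X B fun q hq => (Finset.mem_filter.1 hq).2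
  have hx : ∀ x, 3 * (Finset.univ.filter fun y => Linked (grid n d) X x y).card ≤ 2 * n ^ d := by
    intro x
    by_cases hxX : x ∈ X
    · rw [Finset.filter_false_of_mem fun y _ h => h.1 hxX]
      simp
    have h1 := hX (((grid n d).induce ((X : Set _)ᶜ)).connectedComponentMk ⟨x, hxX⟩)
    have h2 : (Finset.univ.filter fun y => Linked (grid n d) X x y).card ≤
        (((grid n d).induce ((X : Set _)ᶜ)).connectedComponentMk ⟨x, hxX⟩).supp.ncard := by
      rw [← Set.ncard_image_of_injective _ Subtype.val_injective, ← Set.ncard_coe_finset]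
      refine Set.ncard_le_ncard (fun y hy => ?_) (Set.toFinite _)
      obtain ⟨_, hy, h⟩ := (Finset.mem_filter.1 (Finset.mem_coe.1 hy)).2
      exact ⟨⟨y, hy⟩, SimpleGraph.ConnectedComponent.sound h.symm, rfl⟩
    have h3 : ((Finset.univ.filter fun y => Linked (grid n d) X x y).card : ℝ) ≤
        2 * (Fintype.card (Fin d → Fin n) : ℝ) / 3 := le_trans (by exact_mod_cast h2) h1
    simp only [Fintype.card_fun, Fintype.card_fin] at h3
    have h4 : 3 * ((Finset.univ.filter fun y => Linked (grid n d) X x y).card : ℝ) ≤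
        2 * ((n ^ d : ℕ) : ℝ) := by linarith
    exact_mod_cast h4
  have hMcard : 3 * M.card ≤ 2 * n ^ d * n ^ d := by
    have : M.card = ∑ x, (Finset.univ.filter fun y => Linked (grid n d) X x y).card := by
      simp only [hM, Finset.card_filter]
      exact Fintype.sum_prod_type _
    rw [this, Finset.mul_sum]
    calc _ ≤ ∑ _x : Fin d → Fin n, 2 * n ^ d := Finset.sum_le_sum fun x _ => hx x
      _ = _ := by simp [mul_comm]
  obtain ⟨e, rfl⟩ : ∃ e, d = e + 1 := ⟨d - 1, by omega⟩
  rw [Nat.add_sub_cancel]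
  have hpos : 0 < n ^ (e + 1 + 1) := Nat.pow_pos hn
  refine Nat.le_of_mul_le_mul_right ?_ hpos
  have h5 : n ^ e * n ^ (e + 1 + 1) = n ^ (e + 1) * n ^ (e + 1) := by ring
  rw [h5]
  nlinarith

theorem IsBalancedSeparator.map_symm {V V' : Type*} [Fintype V] [Fintype V'] {G : SimpleGraph V}
    {G' : SimpleGraph V'} (f : G ≃g G') {X : Finset V'} (hX : IsBalancedSeparator G' X) :
    IsBalancedSeparator G (X.map f.symm.toEquiv.toEmbedding) := by
  intro C
  let φ : G.induce ((X.map f.symm.toEquiv.toEmbedding : Finset V) : Set V)ᶜ →g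
      G'.induce ((X : Set V')ᶜ) :=
    { toFun := fun v => ⟨f v, fun hv => v.2 (Finset.mem_coe.2 (Finset.mem_map.2
        ⟨f v, hv, f.symm_apply_apply v⟩))⟩
      map_rel' := fun h => f.map_rel_iff.2 h }
  have hφ : Function.Injective φ := fun u v h =>
    Subtype.ext (f.injective (congrArg Subtype.val h))
  have hle : C.supp.ncard ≤ (C.map φ).supp.ncard := by
    rw [← Set.ncard_image_of_injective _ hφ]
    refine Set.ncard_le_ncard ?_ (Set.toFinite _)
    rintro _ ⟨v, hv, rfl⟩
    rw [SimpleGraph.ConnectedComponent.mem_supp_iff] at hv ⊢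
    rw [← hv, SimpleGraph.ConnectedComponent.map_mk]
  rw [Fintype.card_congr f.toEquiv]
  exact le_trans (by exact_mod_cast hle) (hX _)

theorem le_minSeparator_of_iso_grid {n d m : ℕ} (hn : 0 < n) (hd : 0 < d)
    {G : SimpleGraph (Fin m)} (f : grid n d ≃g G) : n ^ (d - 1) ≤ 3 * d * minSeparator G := by
  obtain ⟨X, hX, hcard⟩ :=
    Nat.sInf_mem (s := {k | ∃ X : Finset (Fin m), IsBalancedSeparator G X ∧ X.card = k})
      ⟨_, Finset.univ, isBalancedSeparator_univ G, rfl⟩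
  have := le_card_of_isBalancedSeparator hn hd _ (hX.map_symm f)
  rw [Finset.card_map, hcard] at this
  exact this

/-- The lower bound comes from the grid with `⌊n ^ (1 / d)⌋ ^ d` vertices. -/
theorem le_separator_gridClass {d n : ℕ} (hd : 0 < d) (hn : 1 ≤ n) :
    (n : ℝ) ^ (1 - 1 / (d : ℝ)) ≤
      2 ^ (d - 1) * (3 * d) * ((gridClass d).separator n : ℝ) := by
  have hn' : (1 : ℝ) ≤ n := by exact_mod_cast hn
  have hn0 : (0 : ℝ) ≤ n := by linarith
  set t : ℝ := (n : ℝ) ^ (1 / (d : ℝ)) with ht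
  have ht1 : 1 ≤ t := Real.one_le_rpow hn' (by positivity)
  have htd : t ^ d = n := by
    rw [ht, ← Real.rpow_natCast, ← Real.rpow_mul hn0, one_div_mul_cancel (by positivity),
      Real.rpow_one]
  have hpow : (n : ℝ) ^ (1 - 1 / (d : ℝ)) = t ^ (d - 1) := by
    rw [ht, ← Real.rpow_natCast, ← Real.rpow_mul hn0, Nat.cast_pred hd]
    congr 1
    field_simp
  set N : ℕ := ⌊t⌋₊ with hN
  have hN1 : (N : ℝ) ≤ t := Nat.floor_le (by linarith)
  have hN2 : t < N + 1 := Nat.lt_floor_add_one _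
  have hNpos : 1 ≤ N := Nat.le_floor (by simpa using ht1)
  have hNd : N ^ d ≤ n := by
    have : (N : ℝ) ^ d ≤ n := htd ▸ pow_le_pow_left₀ (by positivity) hN1 d
    exact_mod_cast this
  obtain ⟨G, hG, ⟨f⟩⟩ := exists_mem_gridClass N d
  have hsep : minSeparator G ≤ (gridClass d).separator n :=
    le_csSup ((gridClass d).separatorSizes_bddAbove n) ⟨N ^ d, hNd, G, hG, rfl⟩
  have hlow : N ^ (d - 1) ≤ 3 * d * (gridClass d).separator n :=
    (le_minSeparator_of_iso_grid hNpos hd f).trans (Nat.mul_le_mul_left _ hsep)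
  have hlow' : (N : ℝ) ^ (d - 1) ≤ 3 * d * ((gridClass d).separator n : ℝ) := by
    exact_mod_cast hlow
  have hNpos' : (1 : ℝ) ≤ N := by exact_mod_cast hNpos
  calc (n : ℝ) ^ (1 - 1 / (d : ℝ)) = t ^ (d - 1) := hpow
    _ ≤ (2 * N) ^ (d - 1) := pow_le_pow_left₀ (by linarith) (by linarith) _
    _ = 2 ^ (d - 1) * (N : ℝ) ^ (d - 1) := mul_pow _ _ _
    _ ≤ 2 ^ (d - 1) * (3 * d * ((gridClass d).separator n : ℝ)) := by gcongr
    _ = _ := by ring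

theorem hasSeparatorExponent_gridClass {d : ℕ} (hd : 0 < d) :
    (gridClass d).HasSeparatorExponent (1 / (d : ℝ)) := by
  refine ⟨IsBigO.of_bound (4 * d) (Eventually.of_forall fun n => ?_),
    IsBigO.of_bound (2 ^ (d - 1) * (3 * d)) ?_⟩
  · rw [Real.norm_of_nonneg (by positivity), Real.norm_of_nonneg (by positivity)]
    exact separator_gridClass_le hd n
  · filter_upwards [eventually_ge_atTop 1] with n hn
    rw [Real.norm_of_nonneg (by positivity), Real.norm_of_nonneg (by positivity)]
    exact le_separator_gridClass hd hn

/-! ### The growth of the density and the exponents -/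

theorem hereditary_gridClass (d : ℕ) : (gridClass d).Hereditary := by
  rintro m n H G ⟨N, ⟨g⟩⟩ ⟨f⟩
  exact ⟨N, ⟨g.comp f⟩⟩

theorem isBigOPow_nabla_gridClass (k : ℕ) : IsBigOPow (gridClass (k + k)).nabla (k : ℝ) := by
  refine ⟨17 ^ (k + k), by positivity, ?_⟩
  filter_upwards [eventually_ge_atTop 1] with r hr
  refine (nabla_gridClass_le k hr).trans (le_of_eq ?_)
  rw [Real.rpow_natCast, ← ENNReal.ofReal_natCast]
  push_cast
  rfl

theorem isBigOmegaPow_nabla_gridClass {k : ℕ} (hk : 0 < k) :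
    IsBigOmegaPow (gridClass (k + k)).nabla (k : ℝ) := by
  refine ⟨1 / 3, by positivity, ?_⟩
  filter_upwards [eventually_ge_atTop 1] with r hr
  refine le_trans (le_of_eq ?_) (le_nabla_gridClass hk hr)
  rw [Real.rpow_natCast, one_div_mul_eq_div, ENNReal.ofReal_div_of_pos (by norm_num),
    ← ENNReal.ofReal_natCast]
  push_cast
  simp

theorem IsBigOmegaPow.le_of_isBigOPow {f : ℕ → ℝ≥0∞} {b B : ℝ} (hb : IsBigOmegaPow f b)
    (hB : IsBigOPow f B) : b ≤ B := by
  obtain ⟨c, hc, hcf⟩ := hb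
  obtain ⟨C, hC, hCf⟩ := hB
  by_contra! hlt
  have htend : Tendsto (fun r : ℕ => (r : ℝ) ^ (b - B)) atTop atTop :=
    (tendsto_rpow_atTop (sub_pos.2 hlt)).comp tendsto_natCast_atTop_atTop
  obtain ⟨r, h1, h2, h3, hr⟩ := (hcf.and (hCf.and
    ((htend.eventually_gt_atTop (C / c)).and (eventually_ge_atTop 1)))).exists
  have hr' : (0 : ℝ) < r := by exact_mod_cast hr
  have hle : c * (r : ℝ) ^ b ≤ C * (r : ℝ) ^ B :=
    (ENNReal.ofReal_le_ofReal_iff (by positivity)).1 (h1.trans h2)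
  rw [Real.rpow_sub hr', div_lt_div_iff₀ hc (by positivity)] at h3
  linarith

theorem lowerExponent_le {𝒢 : GraphClass} {ε B : ℝ} (h𝒢 : 𝒢.Hereditary)
    (hε : 𝒢.HasSeparatorExponent ε) (hB : IsBigOPow 𝒢.nabla B) : lowerExponent ε ≤ B := by
  refine sSup_le ?_
  rintro _ ⟨b, hb, rfl⟩
  exact EReal.coe_le_coe_iff.2 ((hb 𝒢 h𝒢 hε).le_of_isBigOPow hB)

theorem le_upperExponent {𝒢 : GraphClass} {ε b : ℝ} (h𝒢 : 𝒢.Hereditary)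
    (hε : 𝒢.HasSeparatorExponent ε) (hb : IsBigOmegaPow 𝒢.nabla b) : b ≤ upperExponent ε := by
  refine le_sInf ?_
  rintro _ ⟨B, hB, rfl⟩
  exact EReal.coe_le_coe_iff.2 (hb.le_of_isBigOPow (hB 𝒢 h𝒢 hε))

end ShallowMinors

theorem mainTheorem4 (d : ℕ) (hd : Even d) (hd0 : 0 < d) :
    (ShallowMinors.lowerExponent (1 / (d : ℝ)) ≤ (((d : ℝ) / 2 : ℝ) : EReal) ∧
      (((d : ℝ) / 2 : ℝ) : EReal) ≤ ShallowMinors.upperExponent (1 / (d : ℝ))) ∧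
    (ShallowMinors.gridClass d).Hereditary ∧
    (ShallowMinors.gridClass d).HasSeparatorExponent (1 / (d : ℝ)) ∧
    ShallowMinors.IsBigOPow (ShallowMinors.gridClass d).nabla ((d : ℝ) / 2) ∧
    ShallowMinors.IsBigOmegaPow (ShallowMinors.gridClass d).nabla ((d : ℝ) / 2) ∧
    (∀ r : ℕ, 1 ≤ r →
      ShallowMinors.IsShallowMinor r
        (completeBipartiteGraph (Fin ((2 * r) ^ (d / 2) / 2)) (Fin ((2 * r) ^ (d / 2))))
        (ShallowMinors.grid (2 * r) d)) := by
  obtain ⟨k, rfl⟩ := hd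
  have hk : 0 < k := by omega
  have hhalf : (((k + k : ℕ) : ℝ) / 2) = k := by
    push_cast
    ring
  have hhalf' : (k + k) / 2 = k := by omega
  rw [hhalf, hhalf']
  have hher := ShallowMinors.hereditary_gridClass (k + k)
  have hsep := ShallowMinors.hasSeparatorExponent_gridClass hd0
  have hO := ShallowMinors.isBigOPow_nabla_gridClass k
  have hΩ := ShallowMinors.isBigOmegaPow_nabla_gridClass hk
  exact ⟨⟨ShallowMinors.lowerExponent_le hher hsep hO, ShallowMinors.le_upperExponent hher hsep hΩ⟩,
    hher, hsep, hO, hΩ, fun r _ => ShallowMinors.isShallowMinor_completeBipartiteGraph k r hk⟩
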